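/- Let $E$ be a Polish space with its Borel $\sigma$-algebra, $n\ge 1$ and $C>0$. For probability measures $P,Q$ on $E^n$ put $$\tilde W(P,Q)=\sup_{\alpha}\ \inf_{\pi}\ \frac{\sum_{j=1}^n \pi[\alpha_j(Y)\,1_{X_j\ne Y_j}]}{\big(\sum_{j=1}^n Q[\alpha_j^2]\big)^{1/2}},\qquad \tfrac00=\tfrac{+\infty}{+\infty}=0,$$ where $\alpha=(\alpha_1,\dots,\alpha_n)$ ranges over the $n$-tuples of lower semicontinuous functions $\alpha_j:E^n\to[0,\infty)$, and $\pi$ over all couplings of $P$ and $Q$, i.e. laws of pairs $(X,Y)$ with $X\sim P$ and $Y\sim Q$. Let $\mathcal K(Q|P)=Q[\log (dQ/dP)]$ be the relative entropy ($+\infty$ if $Q\not\ll P$). Say that $P$ satisfies $\tilde T_{2,1_2}(C)$ if $\tilde W(P,Q)\le\sqrt{2C\,\mathcal K(Q|P)}$ for every probability measure $Q$ on $E^n$, and that it satisfies $\tilde T^{(i)}_{2,1_2}(C)$ if $\tilde W(Q,P)\le\sqrt{2C\,\mathcal K(Q|P)}$ for every such $Q$. For $x\in E^n$ and $A\subset E^n$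 let $$d_T(x,A)=\sup_{\|c\|\le 1}\ \inf_{y\in A}\ \sum_{j=1}^n c_j 1_{x_j\ne y_j},$$ where $c\in\mathbb R^n$ and $\|\cdot\|$ is the Euclidean norm. If the law $P$ of $X=(X_1,\dots,X_n)$ satisfies both $\tilde T_{2,1_2}(C)$ and $\tilde T^{(i)}_{2,1_2}(C)$, then for every measurable set $A\subset E^n$ the function $d_T(\cdot,A)$ is $P$-measurable (measurable with respect to the $P$-completion of the Borel $\sigma$-algebra) and Talagrand's convex distance inequality holds: $$P\Big[\exp\Big(\frac{d_T^2(X,A)}{4C}\Big)\Big]\le\frac1{P(A)},$$ where the right-hand side is $+\infty$ if $P(A)=0$. -/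

import Mathlib

open MeasureTheory InformationTheory
open scoped ENNReal NNReal

/-- The Hamming distance `1_{x ≠ y}` on `E`. -/
noncomputable def hammingMetric {E : Type*} (x y : E) : ℝ≥0∞ :=
  open Classical in if x = y then 0 else 1

/-- `π` is a coupling of `P` (first margin) and `Q` (second margin). -/
def IsCoupling {Ω : Type*} [MeasurableSpace Ω] (π : Measure (Ω × Ω)) (P Q : Measure Ω) : Prop :=
  π.fst = P ∧ π.snd = Q

/-- The weak transport cost with exponents `p = q = 2` on `E^n`, for a metric `d` on `E`:
the supremum over vectors `α = (α_1, …, α_n)` of non-negative lower semicontinuous functions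
on `E^n` of the infimum over the couplings `π` of `P` and `Q` of
`(∑ j, π[α_j(Y) d(X_j, Y_j)]) / (∑ j, Q[α_j ^ 2]) ^ (1/2)`.
The division of `ℝ≥0∞` satisfies `0 / 0 = 0` and `∞ / ∞ = 0`. -/
noncomputable def weakTransportCost {E : Type*} [TopologicalSpace E] [MeasurableSpace E] {n : ℕ}
    (d : E → E → ℝ≥0∞) (P Q : Measure (Fin n → E)) : ℝ≥0∞ :=
  ⨆ (α : Fin n → (Fin n → E) → ℝ≥0) (_ : ∀ j, LowerSemicontinuous (α j)),
    ⨅ (π : Measure ((Fin n → E) × (Fin n → E))) (_ : IsCoupling π P Q),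
      (∑ j, ∫⁻ z, (α j z.2 : ℝ≥0∞) * d (z.1 j) (z.2 j) ∂π) /
        (∑ j, ∫⁻ y, (α j y : ℝ≥0∞) ^ 2 ∂Q) ^ (1 / 2 : ℝ)

/-- The weak transport inequality with `p = 2`, metric `d` and constant `C`. -/
def WeakTransportInequality {E : Type*} [TopologicalSpace E] [MeasurableSpace E] {n : ℕ}
    (d : E → E → ℝ≥0∞) (C : ℝ) (P : Measure (Fin n → E)) : Prop :=
  ∀ Q : Measure (Fin n → E), IsProbabilityMeasure Q →
    weakTransportCost d P Q ≤ (2 * ENNReal.ofReal C * klDiv Q P) ^ (1 / 2 : ℝ)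

/-- The inverted weak transport inequality with `p = 2`, metric `d` and constant `C`. -/
def InvertedWeakTransportInequality {E : Type*} [TopologicalSpace E] [MeasurableSpace E] {n : ℕ}
    (d : E → E → ℝ≥0∞) (C : ℝ) (P : Measure (Fin n → E)) : Prop :=
  ∀ Q : Measure (Fin n → E), IsProbabilityMeasure Q →
    weakTransportCost d Q P ≤ (2 * ENNReal.ofReal C * klDiv Q P) ^ (1 / 2 : ℝ)

/-- Talagrand's convex distance from `x` to a nonempty set `A`; `‖c‖` is the Euclidean norm.
(For `A = ∅` the value is `0`.) -/
noncomputable def convexDistance {E : Type*} {n : ℕ} (x : Fin n → E) (A : Set (Fin n → E)) : ℝ :=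
  open Classical in
  ⨆ c : Metric.closedBall (0 : EuclideanSpace ℝ (Fin n)) 1,
    ⨅ y : A, ∑ j, (c : EuclideanSpace ℝ (Fin n)) j * (if x j = (y : Fin n → E) j then 0 else 1)

/-! Let S be P conditioned on A and let Q be the tilt of P by f = d_T(·,A)²/(4C). At each y some
c(y) ≥ 0 in the unit ball attains d_T(y,A). The weights α_j = c_j d_T then satisfy ∑ α_j² ≤ d_T²,
while ∑ α_j(y) 1_{x_j ≠ y_j} ≥ d_T(y,A)² for every x ∈ A. The inverted inequality moves S to P and
the direct one moves P to Q. Gluing the couplings (`lintegral_le_of_weakTransportCost_lt`) gives,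
for V = Q[d_T²], V ≤ (a + b)√V with a² = 2C K(S|P) and b² = 2C K(Q|P). Hence V ≤ 4C (K(S|P) +
K(Q|P)), which is `integral_sq_le_of_weakTransportInequality`. Now K(S|P) = -log P(A) and K(Q|P) =
Q[f] - log P[e^f]. Since V/(4C) = Q[f], this term cancels and log P[e^f] ≤ -log P(A) remains. The
weights are only measurable, so the cost bound is first extended beyond lower semicontinuous ones.
Measurability of d_T rests on analytic sets being universally measurable. -/

/-! ### Universal measurability of analytic sets -/

open Filter Topology Set in
/-- The continuous image of the Baire space is, up to small measure, a compact image. -/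
theorem exists_isCompact_image_subset_range {X : Type*} [TopologicalSpace X] 
    [TopologicalSpace.MetrizableSpace X] [MeasurableSpace X] [BorelSpace X]
    (μ : Measure X) [IsFiniteMeasure μ]
    {f : (ℕ → ℕ) → X} (hf : Continuous f) {c : ℝ≥0∞} (hc : c < μ (range f)) :
    ∃ K ⊆ range f, IsCompact K ∧ c ≤ μ K := by
  -- Continuity of μ from below allows a cap on one more coordinate while the image keeps measure
  -- above c.
  have step : ∀ (m : ℕ) (D : {D : Set (ℕ → ℕ) // c < μ (f '' D)}),
      ∃ k : ℕ, c < μ (f '' (D.1 ∩ {σ | σ m ≤ k})) := by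
    rintro m ⟨D, hD⟩
    have hU : f '' D = ⋃ k : ℕ, f '' (D ∩ {σ | σ m ≤ k}) := by
      rw [← image_iUnion, ← inter_iUnion]
      congr 1
      refine (inter_eq_left.2 fun σ _ => mem_iUnion.2 ⟨σ m, le_refl (σ m)⟩).symm
    have hmono : Monotone fun k : ℕ => f '' (D ∩ {σ | σ m ≤ k}) := fun a b hab =>
      image_mono (inter_subset_inter_right _ fun σ (h : σ m ≤ a) => h.trans hab)
    rw [hU, hmono.measure_iUnion] at hD
    exact lt_iSup_iff.1 hD
  choose k hk using step
  let D : ℕ → {D : Set (ℕ → ℕ) // c < μ (f '' D)} := fun m =>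
    Nat.rec ⟨univ, by rwa [image_univ]⟩ (fun m D => ⟨D.1 ∩ {σ | σ m ≤ k m D}, hk m D⟩) m
  let l : ℕ → ℕ := fun m => k m (D m)
  have hDsucc : ∀ m, (D (m + 1)).1 = (D m).1 ∩ {σ | σ m ≤ l m} := fun m => rfl
  have hanti : Antitone fun m => (D m).1 := antitone_nat_of_succ_le fun m => by
    rw [hDsucc]; exact inter_subset_left
  have hDl : ∀ m i, i < m → ∀ σ ∈ (D m).1, σ i ≤ l i := by
    intro m i him σ hσ
    have : σ ∈ (D (i + 1)).1 := hanti him hσ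
    rw [hDsucc] at this
    exact this.2
  have hcpt : IsCompact (univ.pi fun i => Iic (l i)) :=
    isCompact_univ_pi fun i => (finite_Iic (l i)).isCompact
  refine ⟨f '' univ.pi fun i => Iic (l i), image_subset_range _ _, hcpt.image hf, ?_⟩
  have hsub : ⋂ m, closure (f '' (D m).1) ⊆ f '' univ.pi fun i => Iic (l i) := by
    intro x hx
    let _ := TopologicalSpace.metrizableSpaceMetric X
    have : ∀ m : ℕ, ∃ σ ∈ (D m).1, dist x (f σ) < 1 / ((m : ℝ) + 1) := fun m => by
      obtain ⟨_, ⟨σ, hσ, rfl⟩, h⟩ := Metric.mem_closure_iff.1 (mem_iInter.1 hx m)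
        (1 / ((m : ℝ) + 1)) (by positivity)
      exact ⟨σ, hσ, h⟩
    choose σ hσ hσx using this
    -- `σ m` obeys the caps only in coordinates below m. Truncating at `l` puts it in the compact
    -- box without changing those coordinates, so the limit is unaffected.
    obtain ⟨τ, hτ, φ, hφ, hlim⟩ := hcpt.tendsto_subseq (x := fun m => σ m ⊓ l)
      fun m i _ => (inf_le_right : σ m i ⊓ l i ≤ l i)
    have hlim' : Tendsto (fun m => σ (φ m)) atTop (𝓝 τ) := by
      rw [tendsto_pi_nhds] at hlim ⊢
      intro i
      refine (hlim i).congr' ?_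
      filter_upwards [eventually_gt_atTop i] with m hm
      exact inf_eq_left.2 (hDl _ i (hm.trans_le hφ.le_apply) _ (hσ _))
    have hx' : Tendsto (fun m => f (σ m)) atTop (𝓝 x) := by
      rw [tendsto_iff_dist_tendsto_zero]
      refine squeeze_zero (fun _ => dist_nonneg) (fun m => ?_)
        tendsto_one_div_add_atTop_nhds_zero_nat
      rw [dist_comm]; exact (hσx m).le
    exact ⟨τ, hτ, tendsto_nhds_unique ((hf.tendsto τ).comp hlim') (hx'.comp hφ.tendsto_atTop)⟩
  refine le_trans ?_ (measure_mono hsub)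
  rw [Antitone.measure_iInter (fun a b hab => closure_mono (image_mono (hanti hab)))
    (fun m => isClosed_closure.measurableSet.nullMeasurableSet) ⟨0, measure_ne_top _ _⟩]
  exact le_iInf fun m => (D m).2.le.trans (measure_mono subset_closure)

open Filter Topology Set in
/-- Analytic sets are universally measurable. -/
theorem MeasureTheory.AnalyticSet.nullMeasurableSet {X : Type*} [TopologicalSpace X]
    [TopologicalSpace.MetrizableSpace X] [MeasurableSpace X] [BorelSpace X] {s : Set X}
    (hs : AnalyticSet s) (μ : Measure X) [IsFiniteMeasure μ] : NullMeasurableSet s μ := by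
  rw [AnalyticSet] at hs
  rcases hs with rfl | ⟨f, hf, rfl⟩
  · exact MeasurableSet.empty.nullMeasurableSet
  rcases eq_or_ne (μ (range f)) 0 with h0 | h0
  · exact NullMeasurableSet.of_null h0
  obtain ⟨u, -, hu, hlim⟩ := exists_seq_strictMono_tendsto' (pos_iff_ne_zero.2 h0)
  choose K hKs hK hKu using fun m => exists_isCompact_image_subset_range μ hf (hu m).2
  have hm : MeasurableSet (⋃ m, K m) := .iUnion fun m => (hK m).isClosed.measurableSet
  refine hm.nullMeasurableSet.congr (ae_eq_of_subset_of_measure_ge (iUnion_subset hKs) ?_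
    hm.nullMeasurableSet (measure_ne_top _ _))
  exact le_of_tendsto' hlim fun m => (hKu m).trans (measure_mono (subset_iUnion K m))

/-! ### Relative entropy of conditioned and tilted measures -/

theorem klDiv_cond {Ω : Type*} [MeasurableSpace Ω] (P : Measure Ω) [IsProbabilityMeasure P]
    {A : Set Ω} (hA : MeasurableSet A) (hPA : P A ≠ 0) :
    klDiv (ProbabilityTheory.cond P A) P = ENNReal.ofReal (-Real.log (P A).toReal) := by
  have : IsProbabilityMeasure (ProbabilityTheory.cond P A) :=
    ProbabilityTheory.cond_isProbabilityMeasure hPA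
  have hac : ProbabilityTheory.cond P A ≪ P := ProbabilityTheory.cond_absolutelyContinuous
  have hd : ProbabilityTheory.cond P A = P.withDensity (A.indicator fun _ => (P A)⁻¹) := by
    rw [withDensity_indicator hA, withDensity_const, ProbabilityTheory.cond]
  have hr : llr (ProbabilityTheory.cond P A) P =ᵐ[ProbabilityTheory.cond P A]
      fun _ => -Real.log (P A).toReal := by
    have h1 : (ProbabilityTheory.cond P A).rnDeriv P =ᵐ[P] A.indicator fun _ => (P A)⁻¹ := by
      rw [hd]
      exact Measure.rnDeriv_withDensity _ (measurable_const.indicator hA)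
    have h2 : ∀ᵐ x ∂ProbabilityTheory.cond P A, x ∈ A := ProbabilityTheory.ae_cond_mem hA
    filter_upwards [hac.ae_le h1, h2] with x hx hxA
    rw [llr, hx, Set.indicator_of_mem hxA, ENNReal.toReal_inv, Real.log_inv]
  rw [klDiv_of_ac_of_integrable hac ((integrable_congr hr).2 (integrable_const _)),
    integral_congr_ae hr]
  simp

theorem toReal_klDiv_tilted {Ω : Type*} [MeasurableSpace Ω] (P : Measure Ω)
    [IsProbabilityMeasure P] {f : Ω → ℝ}
    (he : Integrable (fun x => Real.exp (f x)) P) (hi : Integrable f (P.tilted f)) :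
    klDiv (P.tilted f) P ≠ ⊤ ∧
    (klDiv (P.tilted f) P).toReal =
      ∫ x, f x ∂(P.tilted f) - Real.log (∫ x, Real.exp (f x) ∂P) := by
  have := isProbabilityMeasure_tilted he
  have hac := tilted_absolutelyContinuous P f
  have hr : llr (P.tilted f) P =ᵐ[P.tilted f]
      fun x => f x - Real.log (∫ x, Real.exp (f x) ∂P) :=
    hac.ae_le (log_rnDeriv_tilted_left_self he)
  have hint := (integrable_congr hr).2 (hi.sub (integrable_const _))
  refine ⟨klDiv_ne_top hac hint, ?_⟩
  rw [toReal_klDiv_of_measure_eq hac (by simp), integral_congr_ae hr,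
    integral_sub hi (integrable_const _)]
  simp

/-! ### Weak transport with measurable weights, and gluing of couplings -/

theorem hammingMetric_triangle {E : Type*} (x y z : E) :
    hammingMetric x z ≤ hammingMetric x y + hammingMetric y z := by
  unfold hammingMetric
  by_cases hxy : x = y
  · subst hxy; exact le_add_self
  · rw [if_neg hxy]
    refine le_trans ?_ le_self_add
    split_ifs <;> simp

theorem measurable_hammingMetric {E : Type*} [TopologicalSpace E] [PolishSpace E]
    [MeasurableSpace E] [BorelSpace E] {X : Type*} [MeasurableSpace X] {f g : X → E}
    (hf : Measurable f) (hg : Measurable g) : Measurable fun x => hammingMetric (f x) (g x) :=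
  Measurable.ite (measurableSet_eq_fun hf hg) measurable_const measurable_const

/-- A bounded nonnegative measurable function lies below a lower semicontinuous function with
almost the same second moment. -/
theorem exists_le_lowerSemicontinuous_lintegral_sq_le {X : Type*} [TopologicalSpace X]
    [MeasurableSpace X] [BorelSpace X] (μ : Measure X) [μ.WeaklyRegular] [IsFiniteMeasure μ]
    {f : X → ℝ≥0} (hf : Measurable f) {M : ℝ≥0} (hM : ∀ x, f x ≤ M) {ε : ℝ≥0∞} (hε : ε ≠ 0) :
    ∃ g : X → ℝ≥0, (∀ x, f x ≤ g x) ∧ LowerSemicontinuous g ∧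
      ∫⁻ x, (g x : ℝ≥0∞) ^ 2 ∂μ ≤ ∫⁻ x, (f x : ℝ≥0∞) ^ 2 ∂μ + ε := by
  obtain ⟨h, hfh, hlsc, hint⟩ := exists_le_lowerSemicontinuous_lintegral_ge μ
    (fun x => (f x : ℝ≥0∞) ^ 2) (by fun_prop) hε
  -- The cap at M² makes the root finite; being monotone and continuous, `φ` preserves lower
  -- semicontinuity.
  let φ : ℝ≥0∞ → ℝ≥0 := fun t => NNReal.sqrt (min t ((M : ℝ≥0∞) ^ 2)).toNNReal
  have hfin : ∀ t : ℝ≥0∞, min t ((M : ℝ≥0∞) ^ 2) ≠ ⊤ := fun t =>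
    ((min_le_right _ _).trans_lt (by finiteness)).ne
  have hφm : Monotone φ := fun a b hab => NNReal.sqrt.monotone
    (ENNReal.toNNReal_mono (hfin b) (min_le_min_right _ hab))
  have hφc : Continuous φ := NNReal.continuous_sqrt.comp
    (ENNReal.continuousOn_toNNReal.comp_continuous (continuous_id.min continuous_const) hfin)
  have hφsq : ∀ t, ((φ t : ℝ≥0) : ℝ≥0∞) ^ 2 = min t ((M : ℝ≥0∞) ^ 2) := fun t => by
    rw [← ENNReal.coe_pow, NNReal.sq_sqrt, ENNReal.coe_toNNReal (hfin t)]
  refine ⟨fun x => φ (h x), fun x => ?_, hφc.comp_lowerSemicontinuous hlsc hφm, ?_⟩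
  · rw [← ENNReal.coe_le_coe]
    refine (ENNReal.pow_le_pow_left_iff two_ne_zero).1 ?_
    rw [hφsq]
    exact le_min (hfh x) (by gcongr; exact hM x)
  · refine le_trans (lintegral_mono fun x => ?_) hint
    rw [hφsq]; exact min_le_left _ _

/-- The transport cost controls every bounded measurable weight, not only the lower
semicontinuous ones. -/
theorem exists_isCoupling_of_weakTransportCost_lt {E : Type*} [TopologicalSpace E]
    [PolishSpace E] [MeasurableSpace E] [BorelSpace E] {n : ℕ} {d : E → E → ℝ≥0∞}
    {P Q : Measure (Fin n → E)} [IsProbabilityMeasure Q] {w R : ℝ≥0∞} (hw : w ≠ ⊤)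
    (hPQ : weakTransportCost d P Q < w) {f : Fin n → (Fin n → E) → ℝ≥0}
    (hf : ∀ j, Measurable (f j)) {M : ℝ≥0} (hM : ∀ j x, f j x ≤ M)
    (hR : (∑ j, ∫⁻ y, (f j y : ℝ≥0∞) ^ 2 ∂Q) ^ (1 / 2 : ℝ) < R) :
    ∃ π, IsCoupling π P Q ∧
      ∑ j, ∫⁻ z, (f j z.2 : ℝ≥0∞) * d (z.1 j) (z.2 j) ∂π ≤ w * R := by
  obtain ⟨ε, hε, hεR⟩ : ∃ ε : ℝ≥0∞, ε ≠ 0 ∧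
      (∑ j, (∫⁻ y, (f j y : ℝ≥0∞) ^ 2 ∂Q + ε)) ^ (1 / 2 : ℝ) < R := by
    have hc : Filter.Tendsto
        (fun ε : ℝ≥0∞ => (∑ j, (∫⁻ y, (f j y : ℝ≥0∞) ^ 2 ∂Q + ε)) ^ (1 / 2 : ℝ))
        (nhdsWithin 0 (Set.Ioi 0))
        (nhds ((∑ j, (∫⁻ y, (f j y : ℝ≥0∞) ^ 2 ∂Q + 0)) ^ (1 / 2 : ℝ))) := by
      have : Continuous
          (fun ε : ℝ≥0∞ => (∑ j, (∫⁻ y, (f j y : ℝ≥0∞) ^ 2 ∂Q + ε)) ^ (1 / 2 : ℝ)) :=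
        ENNReal.continuous_rpow_const.comp (by fun_prop)
      exact this.continuousWithinAt.tendsto
    simp only [add_zero] at hc
    obtain ⟨ε, h1, h2⟩ := ((hc.eventually (gt_mem_nhds hR)).and self_mem_nhdsWithin).exists
    exact ⟨ε, ne_of_gt h2, h1⟩
  choose g hfg hg hgi using fun j =>
    exists_le_lowerSemicontinuous_lintegral_sq_le Q (hf j) (hM j) hε
  have h1 := (le_iSup₂_of_le g hg le_rfl).trans_lt hPQ
  simp only [iInf_lt_iff] at h1
  obtain ⟨π, hπ, h1⟩ := h1
  have hgR : (∑ j, ∫⁻ y, (g j y : ℝ≥0∞) ^ 2 ∂Q) ^ (1 / 2 : ℝ) < R := by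
    refine lt_of_le_of_lt ?_ hεR
    gcongr with j
    exact hgi j
  refine ⟨π, hπ, ?_⟩
  calc ∑ j, ∫⁻ z, (f j z.2 : ℝ≥0∞) * d (z.1 j) (z.2 j) ∂π
      ≤ ∑ j, ∫⁻ z, (g j z.2 : ℝ≥0∞) * d (z.1 j) (z.2 j) ∂π := by
        gcongr with j _ z
        exact hfg j _
    _ ≤ w * (∑ j, ∫⁻ y, (g j y : ℝ≥0∞) ^ 2 ∂Q) ^ (1 / 2 : ℝ) :=
        -- If the denominator vanishes, a quotient below the finite `w` forces the numerator to
        -- vanish too; the denominator is finite, so ∞/∞ does not occur.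
        (ENNReal.div_le_iff_le_mul (.inr hw) (.inl hgR.ne_top)).1 h1.le
    _ ≤ w * R := by gcongr

theorem sq_lintegral_le_lintegral_sq {X : Type*} [MeasurableSpace X] (μ : Measure X)
    [IsProbabilityMeasure μ] {f : X → ℝ≥0∞} (hf : AEMeasurable f μ) :
    (∫⁻ x, f x ∂μ) ^ 2 ≤ ∫⁻ x, f x ^ 2 ∂μ := by
  have h := ENNReal.lintegral_mul_le_Lp_mul_Lq μ Real.HolderConjugate.two_two hf
    (aemeasurable_const (b := 1))
  simp only [Pi.mul_apply, mul_one, ENNReal.one_rpow, lintegral_const, measure_univ] at h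
  calc _ ≤ ((∫⁻ x, f x ^ (2 : ℝ) ∂μ) ^ (1 / 2 : ℝ)) ^ 2 := by gcongr
    _ = ∫⁻ x, f x ^ 2 ∂μ := by
      rw [← ENNReal.rpow_natCast, ← ENNReal.rpow_mul]
      simp

open ProbabilityTheory in
/-- The triangle inequality for weak transport, between a measure carried by `A` and `Q`. -/
theorem lintegral_le_of_weakTransportCost_lt {E : Type*} [TopologicalSpace E] [PolishSpace E]
    [MeasurableSpace E] [BorelSpace E] {n : ℕ} {S P Q : Measure (Fin n → E)}
    [IsProbabilityMeasure S] [IsProbabilityMeasure P] [IsProbabilityMeasure Q]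
    {a b r : ℝ≥0∞} (ha : a ≠ ⊤) (hb : b ≠ ⊤)
    (hSP : weakTransportCost hammingMetric S P < a)
    (hPQ : weakTransportCost hammingMetric P Q < b) {α : Fin n → (Fin n → E) → ℝ≥0}
    (hα : ∀ j, Measurable (α j)) {M : ℝ≥0} (hM : ∀ j x, α j x ≤ M)
    (hr : (∑ j, ∫⁻ y, (α j y : ℝ≥0∞) ^ 2 ∂Q) ^ (1 / 2 : ℝ) < r)
    {A : Set (Fin n → E)} (hSA : ∀ᵐ x ∂S, x ∈ A) {f : (Fin n → E) → ℝ≥0∞} (hf : Measurable f)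
    (hfα : ∀ᵐ y ∂Q, ∀ x ∈ A, f y ≤ ∑ j, (α j y : ℝ≥0∞) * hammingMetric (x j) (y j)) :
    ∫⁻ y, f y ∂Q ≤ (a + b) * r := by
  obtain ⟨π₂, ⟨hπP, hπQ⟩, hπ₂⟩ :=
    exists_isCoupling_of_weakTransportCost_lt hb hPQ hα hM hr
  have : Nonempty (Fin n → E) := nonempty_of_isProbabilityMeasure P
  have : IsFiniteMeasure π₂ := ⟨by
    rw [← Measure.snd_univ, hπQ]; simp⟩
  let κ := π₂.condKernel
  have hdis : P ⊗ₘ κ = π₂ := by rw [← hπP]; exact π₂.disintegrate κ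
  -- The conditional mean of α_j(Y) given the intermediate point Z = z is the weight seen by the
  -- coupling of S and P. By Jensen its second moment is no larger than that of α_j.
  let β : Fin n → (Fin n → E) → ℝ≥0 := fun j z => (∫⁻ y, (α j y : ℝ≥0∞) ∂κ z).toNNReal
  have hle : ∀ j z, ∫⁻ y, (α j y : ℝ≥0∞) ∂κ z ≤ M := fun j z =>
    (lintegral_mono fun y => ENNReal.coe_le_coe.2 (hM j y)).trans (by simp)
  have hβ : ∀ j z, (β j z : ℝ≥0∞) = ∫⁻ y, (α j y : ℝ≥0∞) ∂κ z := fun j z =>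
    ENNReal.coe_toNNReal ((hle j z).trans_lt (by finiteness)).ne
  have hαm : ∀ j, Measurable fun y => (α j y : ℝ≥0∞) := fun j => (hα j).coe_nnreal_ennreal
  have hβm : ∀ j, Measurable (β j) := fun j => ((hαm j).lintegral_kernel).ennreal_toNNReal
  have hβM : ∀ j z, β j z ≤ M := fun j z => by
    rw [← ENNReal.coe_le_coe, hβ]; exact hle j z
  have hQ : ∀ g : (Fin n → E) → ℝ≥0∞, Measurable g →
      ∫⁻ z, ∫⁻ y, g y ∂κ z ∂P = ∫⁻ y, g y ∂Q := fun g hg => by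
    rw [← hπQ, Measure.snd, lintegral_map hg measurable_snd, ← hdis,
      Measure.lintegral_compProd (f := fun p => g p.2) (hg.comp measurable_snd)]
  have hβr : (∑ j, ∫⁻ y, (β j y : ℝ≥0∞) ^ 2 ∂P) ^ (1 / 2 : ℝ) < r := by
    refine lt_of_le_of_lt (ENNReal.rpow_le_rpow (Finset.sum_le_sum fun j _ => ?_) (by norm_num)) hr
    rw [← hQ _ ((hαm j).pow_const 2)]
    refine lintegral_mono fun z => ?_
    rw [hβ]
    exact sq_lintegral_le_lintegral_sq _ (hαm j).aemeasurable
  obtain ⟨π₁, ⟨hπS, hπP'⟩, hπ₁⟩ :=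
    exists_isCoupling_of_weakTransportCost_lt ha hSP hβm hβM hβr
  have hP : ∀ g : (Fin n → E) → ℝ≥0∞, Measurable g →
      ∫⁻ p, g p.2 ∂π₁ = ∫⁻ z, g z ∂P := fun g hg => by
    rw [← hπP', Measure.snd, lintegral_map hg measurable_snd]
  have hA : ∀ᵐ p ∂π₁, p.1 ∈ A := by
    rw [← hπS, Measure.fst] at hSA
    exact ae_of_ae_map measurable_fst.aemeasurable hSA
  have hκ : ∀ᵐ p ∂π₁, ∀ᵐ y ∂κ p.2, ∀ x ∈ A,
      f y ≤ ∑ j, (α j y : ℝ≥0∞) * hammingMetric (x j) (y j) := by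
    rw [← hπQ, Measure.snd] at hfα
    have h := ae_of_ae_map measurable_snd.aemeasurable hfα
    rw [← hdis] at h
    have h' := Measure.ae_ae_of_ae_compProd h
    rw [← hπP', Measure.snd] at h'
    exact ae_of_ae_map measurable_snd.aemeasurable h'
  have hdm : ∀ j, Measurable fun p : (Fin n → E) × (Fin n → E) =>
      (α j p.2 : ℝ≥0∞) * hammingMetric (p.1 j) (p.2 j) := fun j =>
    ((hαm j).comp measurable_snd).mul (measurable_hammingMetric
      ((measurable_pi_apply j).comp measurable_fst) ((measurable_pi_apply j).comp measurable_snd))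
  have hdz : ∀ j (z : Fin n → E), Measurable fun y : Fin n → E =>
      (α j y : ℝ≥0∞) * hammingMetric (z j) (y j) := fun j z =>
    (hdm j).comp (measurable_const.prodMk measurable_id)
  have hdκ : ∀ j, Measurable fun z : Fin n → E =>
      ∫⁻ y, (α j y : ℝ≥0∞) * hammingMetric (z j) (y j) ∂κ z := fun j =>
    (hdm j).lintegral_kernel_prod_right'
  have hbm : ∀ j, Measurable fun p : (Fin n → E) × (Fin n → E) =>
      (β j p.2 : ℝ≥0∞) * hammingMetric (p.1 j) (p.2 j) := fun j =>
    ((hβm j).coe_nnreal_ennreal.comp measurable_snd).mul (measurable_hammingMetric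
      ((measurable_pi_apply j).comp measurable_fst) ((measurable_pi_apply j).comp measurable_snd))
  -- Draw (X, Z) from `π₁`, then Y from `κ Z`: Y has law Q, X lies in A, and the Hamming triangle
  -- inequality splits the cost at Z.
  calc ∫⁻ y, f y ∂Q = ∫⁻ p, ∫⁻ y, f y ∂κ p.2 ∂π₁ := by
        rw [hP _ hf.lintegral_kernel, hQ f hf]
    _ ≤ ∫⁻ p, (∑ j, (β j p.2 : ℝ≥0∞) * hammingMetric (p.1 j) (p.2 j) +
          ∑ j, ∫⁻ y, (α j y : ℝ≥0∞) * hammingMetric (p.2 j) (y j) ∂κ p.2) ∂π₁ := by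
        refine lintegral_mono_ae ?_
        filter_upwards [hA, hκ] with p hpA hp
        calc ∫⁻ y, f y ∂κ p.2
            ≤ ∫⁻ y, ∑ j, ((α j y : ℝ≥0∞) * hammingMetric (p.1 j) (p.2 j) +
                (α j y : ℝ≥0∞) * hammingMetric (p.2 j) (y j)) ∂κ p.2 := by
              refine lintegral_mono_ae ?_
              filter_upwards [hp] with y hy
              refine (hy _ hpA).trans ?_
              gcongr with j
              rw [← mul_add]
              gcongr
              exact hammingMetric_triangle _ _ _
          _ = _ := by
              rw [lintegral_finsetSum (f := fun j y => (α j y : ℝ≥0∞) * hammingMetric (p.1 j) (p.2 j)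
                  + (α j y : ℝ≥0∞) * hammingMetric (p.2 j) (y j)) _
                  fun j _ => ((hαm j).mul_const _).add (hdz j _), ← Finset.sum_add_distrib]
              refine Finset.sum_congr rfl fun j _ => ?_
              rw [lintegral_add_left ((hαm j).mul_const _), lintegral_mul_const _ (hαm j), hβ]
    _ ≤ a * r + b * r := by
        rw [lintegral_add_left (Finset.measurable_sum _ fun j _ => hbm j),
          lintegral_finsetSum _ fun j _ => hbm j,
          lintegral_finsetSum (f := fun j (p : (Fin n → E) × (Fin n → E)) =>
            ∫⁻ y, (α j y : ℝ≥0∞) *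
            hammingMetric (p.2 j) (y j) ∂κ p.2) _ fun j _ => (hdκ j).comp measurable_snd]
        refine add_le_add hπ₁ (le_trans (le_of_eq ?_) hπ₂)
        refine Finset.sum_congr rfl fun j _ => ?_
        rw [hP _ (hdκ j), ← hdis, Measure.lintegral_compProd (hdm j)]
    _ = (a + b) * r := (add_mul _ _ _).symm

/-! ### The convex distance as a function of finite data -/

/-- The sets of coordinates in which `x` can differ from a point of `A`. -/
def mismatchSets {E : Type*} {n : ℕ} (A : Set (Fin n → E)) (x : Fin n → E) :
    Set (Finset (Fin n)) :=
  {J | ∃ y ∈ A, ∀ j, j ∈ J ↔ x j ≠ y j}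

/-- The convex distance as a function of the attained sets of differing coordinates. -/
noncomputable def convexGauge {n : ℕ} (S : Set (Finset (Fin n))) : ℝ :=
  ⨆ c : Metric.closedBall (0 : EuclideanSpace ℝ (Fin n)) 1,
    ⨅ J : S, ∑ j ∈ J.1, (c : EuclideanSpace ℝ (Fin n)) j

theorem convexDistance_eq_convexGauge {E : Type*} {n : ℕ} (A : Set (Fin n → E))
    (x : Fin n → E) : convexDistance x A = convexGauge (mismatchSets A x) := by
  classical
  unfold convexDistance convexGauge
  refine iSup_congr fun c => ?_
  let e : A → mismatchSets A x := fun y =>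
    ⟨Finset.univ.filter fun j => x j ≠ y.1 j, y.1, y.2, fun j => by simp⟩
  refine Function.Surjective.iInf_congr e ?_ fun y => ?_
  · rintro ⟨J, y, hy, hJ⟩
    refine ⟨⟨y, hy⟩, Subtype.ext (Finset.ext fun j => ?_)⟩
    simp [e, hJ]
  · rw [Finset.sum_filter]
    refine Finset.sum_congr rfl fun j _ => ?_
    by_cases h : x j = y.1 j <;> simp [h]

/-- An infimum of linear forms is upper semicontinuous, so it has a maximiser on the compact ball.
Taking absolute values keeps its norm and can only increase the sums. -/
theorem exists_le_sum_convexGauge {n : ℕ} (S : Set (Finset (Fin n))) :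
    0 ≤ convexGauge S ∧ ∃ c : Fin n → ℝ, (∀ j, 0 ≤ c j) ∧ ∑ j, c j ^ 2 ≤ 1 ∧
      ∀ J ∈ S, convexGauge S ≤ ∑ j ∈ J, c j := by
  let φ : EuclideanSpace ℝ (Fin n) → ℝ := fun c => ⨅ J : S, ∑ j ∈ J.1, c j
  have hbdd : ∀ c : EuclideanSpace ℝ (Fin n),
      BddBelow (Set.range fun J : S => ∑ j ∈ J.1, c j) := fun c =>
    (Set.finite_range _).bddBelow
  have hφ : UpperSemicontinuous φ := upperSemicontinuous_ciInf (fun c => hbdd c) fun J =>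
    Continuous.upperSemicontinuous (by fun_prop)
  obtain ⟨c, hc, hmax⟩ := UpperSemicontinuousOn.exists_isMaxOn
    (Metric.nonempty_closedBall.2 zero_le_one)
    (isCompact_closedBall (0 : EuclideanSpace ℝ (Fin n)) 1) (hφ.upperSemicontinuousOn _)
  have hle : ∀ c' : Metric.closedBall (0 : EuclideanSpace ℝ (Fin n)) 1, φ c' ≤ φ c :=
    fun c' => hmax c'.2
  have : Nonempty (Metric.closedBall (0 : EuclideanSpace ℝ (Fin n)) 1) := ⟨⟨c, hc⟩⟩
  have hg : convexGauge S ≤ φ c := ciSup_le hle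
  refine ⟨?_, fun j => |c j|, fun j => abs_nonneg _, ?_, fun J hJ => ?_⟩
  · have h0 := le_ciSup (f := fun c' : Metric.closedBall (0 : EuclideanSpace ℝ (Fin n)) 1 => φ c')
      ⟨φ c, Set.forall_mem_range.2 hle⟩ ⟨0, Metric.mem_closedBall_self zero_le_one⟩
    have h1 : φ 0 = 0 := by simp [φ]
    exact h1.symm.le.trans h0
  · rw [mem_closedBall_zero_iff, ← sq_le_one_iff₀ (norm_nonneg _), EuclideanSpace.norm_sq_eq] at hc
    simpa using hc
  · exact hg.trans ((ciInf_le (hbdd c) ⟨J, hJ⟩).trans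
      (Finset.sum_le_sum fun j _ => le_abs_self _))

/-- For each J, the points x whose mismatch sets include J form the projection of a Borel set, which
is analytic. There are only finitely many J. -/
theorem aemeasurable_mismatchSets {E : Type*} [TopologicalSpace E] [PolishSpace E]
    [MeasurableSpace E] [BorelSpace E] {n : ℕ} {A : Set (Fin n → E)} (hA : MeasurableSet A)
    (P : Measure (Fin n → E)) [IsFiniteMeasure P] : AEMeasurable (mismatchSets A) P := by
  have hnull : ∀ J : Finset (Fin n), NullMeasurableSet {x | J ∈ mismatchSets A x} P := by
    intro J
    have hm : MeasurableSet {p : (Fin n → E) × (Fin n → E) |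
        p.2 ∈ A ∧ ∀ j, j ∈ J ↔ p.1 j ≠ p.2 j} := by
      refine (measurable_snd hA).inter
        (s₂ := {p : (Fin n → E) × (Fin n → E) | ∀ j, j ∈ J ↔ p.1 j ≠ p.2 j}) ?_
      rw [Set.ofPred_forall]
      refine MeasurableSet.iInter fun j => ?_
      have hj : MeasurableSet {p : (Fin n → E) × (Fin n → E) | p.1 j = p.2 j} :=
        measurableSet_eq_fun ((measurable_pi_apply j).comp measurable_fst)
          ((measurable_pi_apply j).comp measurable_snd)
      by_cases h : j ∈ J
      · simp only [h, true_iff]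
        exact hj.compl
      · simp only [h, false_iff, not_not]
        exact hj
    have : {x | J ∈ mismatchSets A x} = Prod.fst '' {p : (Fin n → E) × (Fin n → E) |
        p.2 ∈ A ∧ ∀ j, j ∈ J ↔ p.1 j ≠ p.2 j} := by
      ext x
      simp [mismatchSets]
    rw [this]
    exact (hm.analyticSet.image_of_continuous continuous_fst).nullMeasurableSet P
  choose T hT hTm hTe using fun J => (hnull J).exists_measurable_superset_ae_eq
  refine ⟨fun x => {J | x ∈ T J}, measurable_set_iff.2 fun J => measurableSet_setOfPred.1 (hTm J), ?_⟩
  filter_upwards [ae_all_iff.2 fun J => (hTe J).mem_iff] with x hx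
  ext J
  exact (hx J).symm

/-! ### The second moment bound -/

theorem le_ofReal_sqrt_of_le {W K : ℝ≥0∞} {C : ℝ} (hC : 0 ≤ C) (hK : K ≠ ⊤)
    (h : W ≤ (2 * ENNReal.ofReal C * K) ^ (1 / 2 : ℝ)) :
    W ≤ ENNReal.ofReal (√(2 * C * K.toReal)) := by
  refine h.trans (le_of_eq ?_)
  rw [Real.sqrt_eq_rpow, ← ENNReal.ofReal_rpow_of_nonneg (by positivity) (by norm_num),
    ENNReal.ofReal_mul (by positivity), ENNReal.ofReal_mul (by norm_num), ENNReal.ofReal_toReal hK]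
  simp

/-- The slack δ comes from the strict inequalities required for choosing couplings. Let δ → 0,
divide by √V and use (a + b)² ≤ 2(a² + b²). -/
theorem le_of_forall_pos_le_mul_sqrt {V a b : ℝ} (hV : 0 ≤ V) (ha : 0 ≤ a) (hb : 0 ≤ b)
    (h : ∀ δ > 0, V ≤ (a + δ + (b + δ)) * (√V + δ)) : V ≤ 2 * (a ^ 2 + b ^ 2) := by
  have hc : Continuous fun δ : ℝ => (a + δ + (b + δ)) * (√V + δ) := by fun_prop
  have hlim : V ≤ (a + 0 + (b + 0)) * (√V + 0) :=
    ge_of_tendsto (hc.continuousWithinAt (s := Set.Ioi 0) (x := 0)).tendsto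
      (Filter.eventually_of_mem self_mem_nhdsWithin h)
  simp only [add_zero] at hlim
  have hs := Real.sqrt_nonneg V
  have hsq := Real.sq_sqrt hV
  have hle : √V ≤ a + b := by
    rcases hs.eq_or_lt with h0 | h0
    · rw [← h0]; positivity
    · refine le_of_mul_le_mul_right ?_ h0
      nlinarith
  nlinarith [sq_nonneg (a - b)]

/-- The second moment of the convex distance is controlled by the relative entropies. -/
theorem integral_sq_le_of_weakTransportInequality {E : Type*} [TopologicalSpace E]
    [PolishSpace E] [MeasurableSpace E] [BorelSpace E] {n : ℕ} {P S Q : Measure (Fin n → E)}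
    [IsProbabilityMeasure P] [IsProbabilityMeasure S] [IsProbabilityMeasure Q] {C : ℝ}
    (hC : 0 < C) (hT : WeakTransportInequality hammingMetric C P)
    (hTi : InvertedWeakTransportInequality hammingMetric C P)
    (hS : klDiv S P ≠ ⊤) (hQ : klDiv Q P ≠ ⊤) {A : Set (Fin n → E)} (hSA : ∀ᵐ x ∂S, x ∈ A)
    {σ : (Fin n → E) → Set (Finset (Fin n))} (hσ : Measurable σ)
    (hσA : ∀ᵐ y ∂Q, mismatchSets A y = σ y) :
    ∫ y, convexGauge (σ y) ^ 2 ∂Q ≤ 4 * C * ((klDiv S P).toReal + (klDiv Q P).toReal) := by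
  -- The maximiser is chosen as a function on a finite discrete type, so composing it with `σ` is
  -- measurable without any selection theorem.
  choose h0 c hc0 hc1 hc using fun S : Set (Finset (Fin n)) => exists_le_sum_convexGauge S
  obtain ⟨B, hB⟩ := (Set.finite_range (convexGauge (n := n))).bddAbove
  have hB : ∀ S : Set (Finset (Fin n)), convexGauge S ≤ B := fun S => hB ⟨S, rfl⟩
  have hm : Measurable fun y => convexGauge (σ y) := (Measurable.of_discrete (f := convexGauge)).comp hσ
  have hint : Integrable (fun y => convexGauge (σ y) ^ 2) Q :=
    .of_bound (hm.pow_const 2).aestronglyMeasurable (B ^ 2) (.of_forall fun y => by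
      rw [Real.norm_of_nonneg (by positivity)]
      exact pow_le_pow_left₀ (h0 _) (hB _) 2)
  set V := ∫ y, convexGauge (σ y) ^ 2 ∂Q with hVdef
  have hV : 0 ≤ V := integral_nonneg fun y => by positivity
  have hVl : ∫⁻ y, ENNReal.ofReal (convexGauge (σ y) ^ 2) ∂Q = ENNReal.ofReal V :=
    (ofReal_integral_eq_lintegral_ofReal hint (.of_forall fun y => by positivity)).symm
  let α : Fin n → (Fin n → E) → ℝ≥0 := fun j y =>
    (c (σ y) j).toNNReal * (convexGauge (σ y)).toNNReal
  have hαm : ∀ j, Measurable (α j) := fun j =>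
    (Measurable.of_discrete (f := fun T : Set (Finset (Fin n)) =>
      (c T j).toNNReal * (convexGauge T).toNNReal)).comp hσ
  have hcle : ∀ T j, c T j ≤ 1 := fun T j => by
    rw [← sq_le_one_iff₀ (hc0 T j)]
    exact (Finset.single_le_sum (f := fun j => c T j ^ 2) (fun _ _ => by positivity)
      (Finset.mem_univ j)).trans (hc1 T)
  have hαM : ∀ j y, α j y ≤ B.toNNReal := fun j y => by
    calc α j y ≤ 1 * B.toNNReal :=
          mul_le_mul' (by simpa using hcle (σ y) j) (Real.toNNReal_mono (hB _))
      _ = _ := one_mul _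
  have hα2 : ∑ j, ∫⁻ y, (α j y : ℝ≥0∞) ^ 2 ∂Q ≤ ENNReal.ofReal V := by
    rw [← lintegral_finsetSum _ fun j _ => ((hαm j).coe_nnreal_ennreal.pow_const 2), ← hVl]
    refine lintegral_mono fun y => ?_
    calc ∑ j, (α j y : ℝ≥0∞) ^ 2
        = ENNReal.ofReal (∑ j, c (σ y) j ^ 2 * convexGauge (σ y) ^ 2) := by
          rw [ENNReal.ofReal_sum_of_nonneg fun j _ => by positivity]
          refine Finset.sum_congr rfl fun j _ => ?_
          rw [← mul_pow, ENNReal.ofReal_pow (mul_nonneg (hc0 _ _) (h0 _)),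
            ENNReal.ofReal_mul (hc0 _ _)]
          simp only [α, ENNReal.coe_mul, ENNReal.ofReal]
      _ ≤ ENNReal.ofReal (convexGauge (σ y) ^ 2) := by
          rw [← Finset.sum_mul]
          exact ENNReal.ofReal_le_ofReal (mul_le_of_le_one_left (by positivity) (hc1 _))
  have hle : ∀ᵐ y ∂Q, ∀ x ∈ A, ENNReal.ofReal (convexGauge (σ y) ^ 2) ≤
      ∑ j, (α j y : ℝ≥0∞) * hammingMetric (x j) (y j) := by
    classical
    filter_upwards [hσA] with y hy x hx
    have hJ : (Finset.univ.filter fun j => y j ≠ x j) ∈ σ y := by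
      rw [← hy]; exact ⟨x, hx, fun j => by simp⟩
    calc ENNReal.ofReal (convexGauge (σ y) ^ 2)
        ≤ ENNReal.ofReal (∑ j ∈ Finset.univ.filter (fun j => y j ≠ x j),
            c (σ y) j * convexGauge (σ y)) := by
          rw [← Finset.sum_mul, sq]
          exact ENNReal.ofReal_le_ofReal (mul_le_mul_of_nonneg_right (hc _ _ hJ) (h0 _))
      _ = ∑ j ∈ Finset.univ.filter (fun j => y j ≠ x j), (α j y : ℝ≥0∞) := by
          rw [ENNReal.ofReal_sum_of_nonneg fun j _ => mul_nonneg (hc0 _ _) (h0 _)]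
          refine Finset.sum_congr rfl fun j _ => ?_
          rw [ENNReal.ofReal_mul (hc0 _ _)]
          simp only [α, ENNReal.coe_mul, ENNReal.ofReal]
      _ = ∑ j, (α j y : ℝ≥0∞) * hammingMetric (x j) (y j) := by
          rw [Finset.sum_filter]
          refine Finset.sum_congr rfl fun j _ => ?_
          unfold hammingMetric
          by_cases h : x j = y j
          · simp [h]
          · simp [h, Ne.symm h]
  have hkS := ENNReal.toReal_nonneg (a := klDiv S P)
  have hkQ := ENNReal.toReal_nonneg (a := klDiv Q P)
  have hmain := le_of_forall_pos_le_mul_sqrt hV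
    (Real.sqrt_nonneg (2 * C * (klDiv S P).toReal))
    (Real.sqrt_nonneg (2 * C * (klDiv Q P).toReal)) fun δ hδ => by
      have hlt : ∀ t : ℝ, 0 ≤ t → ENNReal.ofReal t < ENNReal.ofReal (t + δ) := fun t ht =>
        (ENNReal.ofReal_lt_ofReal_iff (by positivity)).2 (by linarith)
      have hr : (∑ j, ∫⁻ y, (α j y : ℝ≥0∞) ^ 2 ∂Q) ^ (1 / 2 : ℝ) < ENNReal.ofReal (√V + δ) := by
        refine lt_of_le_of_lt ?_ (hlt _ (Real.sqrt_nonneg _))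
        rw [Real.sqrt_eq_rpow, ← ENNReal.ofReal_rpow_of_nonneg hV (by norm_num)]
        exact ENNReal.rpow_le_rpow hα2 (by norm_num)
      have := lintegral_le_of_weakTransportCost_lt ENNReal.ofReal_ne_top ENNReal.ofReal_ne_top
        ((le_ofReal_sqrt_of_le hC.le hS (hTi S inferInstance)).trans_lt (hlt _ (Real.sqrt_nonneg _)))
        ((le_ofReal_sqrt_of_le hC.le hQ (hT Q inferInstance)).trans_lt (hlt _ (Real.sqrt_nonneg _)))
        hαm hαM hr hSA (hm.pow_const 2).ennreal_ofReal hle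
      rwa [hVl, ← ENNReal.ofReal_add (by positivity) (by positivity),
        ← ENNReal.ofReal_mul (by positivity), ENNReal.ofReal_le_ofReal_iff (by positivity)] at this
  rw [Real.sq_sqrt (by positivity), Real.sq_sqrt (by positivity)] at hmain
  linarith

/-! ### Talagrand's inequality -/

theorem mainTheorem6 {E : Type*} [TopologicalSpace E] [PolishSpace E] [MeasurableSpace E]
    [BorelSpace E] {n : ℕ} (P : Measure (Fin n → E)) [IsProbabilityMeasure P]
    {C : ℝ} (hC : 0 < C)
    (hT : WeakTransportInequality hammingMetric C P)
    (hTi : InvertedWeakTransportInequality hammingMetric C P)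
    {A : Set (Fin n → E)} (hA : MeasurableSet A) :
    AEMeasurable (fun x => convexDistance x A) P ∧
      ∫⁻ x, ENNReal.ofReal (Real.exp (convexDistance x A ^ 2 / (4 * C))) ∂P ≤ 1 / P A := by
  obtain ⟨σ, hσ, hσA⟩ := aemeasurable_mismatchSets hA P
  have hm : Measurable fun x => convexGauge (σ x) := (Measurable.of_discrete (f := convexGauge)).comp hσ
  have hae : (fun x => convexDistance x A) =ᵐ[P] fun x => convexGauge (σ x) := by
    filter_upwards [hσA] with x hx
    rw [convexDistance_eq_convexGauge, hx]
  refine ⟨⟨_, hm, hae⟩, ?_⟩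
  rcases eq_or_ne (P A) 0 with hPA | hPA
  · simp [hPA]
  set f : (Fin n → E) → ℝ := fun x => convexGauge (σ x) ^ 2 / (4 * C) with hf
  have hfm : Measurable f := (hm.pow_const 2).div_const _
  obtain ⟨B, hB⟩ := (Set.finite_range fun S : Set (Finset (Fin n)) =>
    convexGauge S ^ 2 / (4 * C)).bddAbove
  have hfB : ∀ x, f x ≤ B := fun x => hB ⟨σ x, rfl⟩
  have hf0 : ∀ x, 0 ≤ f x := fun x => by positivity
  have he : Integrable (fun x => Real.exp (f x)) P :=
    .of_bound hfm.exp.aestronglyMeasurable (Real.exp B) (.of_forall fun x => by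
      rw [Real.norm_of_nonneg (by positivity)]
      exact Real.exp_le_exp.2 (hfB x))
  have := isProbabilityMeasure_tilted he
  have : IsProbabilityMeasure (ProbabilityTheory.cond P A) :=
    ProbabilityTheory.cond_isProbabilityMeasure hPA
  have hi : Integrable f (P.tilted f) :=
    .of_bound hfm.aestronglyMeasurable B (.of_forall fun x => by
      rw [Real.norm_of_nonneg (hf0 x)]
      exact hfB x)
  obtain ⟨hQtop, hQ⟩ := toReal_klDiv_tilted P he hi
  have hS := klDiv_cond P hA hPA
  have hp0 : 0 < (P A).toReal := ENNReal.toReal_pos hPA (measure_ne_top _ _)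
  have hp1 : (P A).toReal ≤ 1 := measureReal_le_one
  have hV := integral_sq_le_of_weakTransportInequality hC hT hTi
    (by rw [hS]; exact ENNReal.ofReal_ne_top) hQtop (ProbabilityTheory.ae_cond_mem hA) hσ
    ((tilted_absolutelyContinuous P f).ae_le hσA)
  have hfV : ∫ x, f x ∂P.tilted f = (∫ x, convexGauge (σ x) ^ 2 ∂P.tilted f) / (4 * C) :=
    integral_div _ _
  rw [hS, hQ, ENNReal.toReal_ofReal (by linarith [Real.log_nonpos hp0.le hp1]), hfV,
    ← div_le_iff₀' (by positivity)] at hV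
  have hZ0 : 0 < ∫ x, Real.exp (f x) ∂P := integral_exp_pos he
  -- Both sides of `hV` contain the same finite term Q[f], which cancels.
  have hZ : ∫ x, Real.exp (f x) ∂P ≤ (P A).toReal⁻¹ := by
    rw [← Real.log_le_log_iff hZ0 (by positivity), Real.log_inv]
    linarith
  calc ∫⁻ x, ENNReal.ofReal (Real.exp (convexDistance x A ^ 2 / (4 * C))) ∂P
      = ∫⁻ x, ENNReal.ofReal (Real.exp (f x)) ∂P := by
        refine lintegral_congr_ae ?_
        filter_upwards [hae] with x hx
        rw [hf, hx]
    _ = ENNReal.ofReal (∫ x, Real.exp (f x) ∂P) :=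
        (ofReal_integral_eq_lintegral_ofReal he (.of_forall fun x => by positivity)).symm
    _ ≤ ENNReal.ofReal (P A).toReal⁻¹ := ENNReal.ofReal_le_ofReal hZ
    _ = 1 / P A := by
        rw [ENNReal.ofReal_inv_of_pos hp0, ENNReal.ofReal_toReal (measure_ne_top _ _), one_div]
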